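/- For positive integers $n$ and $d$, let $M(n,d)$ denote the largest size of a non-empty set $P$ of permutations of $\{0,1,\ldots,n-1\}$ with Hamming distance at least $d$, that is, such that any two distinct $\sigma,\tau\in P$ satisfy $|\{x : \sigma(x)\neq\tau(x)\}|\geq d$. Let $q = p^k$ with $p$ prime and $k \geq 2$, and let $k^*$ be the largest proper divisor of $k$ (the largest divisor of $k$ that is less than $k$). Let $m$ be a positive integer such that $q - p^{k^*} - 2m > 0$ and $kq(q-1) \not\equiv 0 \pmod{2i+1}$ for every $i \in \{1, \ldots, m\}$. Then: 1. $M(q - m,\; q - p^{k^*} - 2m) \geq kq(q-1)$. 2. If $q + 1 - 3m \geq q - p^{k^*} - 2m$, then $M(q + 1 - m,\; q - p^{k^*} - 2m) \geq kq(q-1)(q+1)$. -/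

import Mathlib

/-- A permutation array on the `n` symbols `0, …, n - 1`, i.e. a non-empty set of permutations of
them, whose Hamming distance is at least `d`: any two distinct members differ at `d` or more
symbols (a one-element array satisfies this for every `d`). -/
def IsPermArrayWithDist (n d : ℕ) (P : Finset (Equiv.Perm (Fin n))) : Prop :=
  P.Nonempty ∧ ∀ σ ∈ P, ∀ τ ∈ P, σ ≠ τ → d ≤ hammingDist (σ : Fin n → Fin n) (τ : Fin n → Fin n)

/-- `M(n,d)`: the maximum size of a permutation array on `n` symbols with Hamming distance at
least `d`. -/
noncomputable def maxPermArray (n d : ℕ) : ℕ :=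
  sSup {N : ℕ | ∃ P : Finset (Equiv.Perm (Fin n)), IsPermArrayWithDist n d P ∧ P.card = N}

/-- The supremum defining `M(n,d)` is always an attained maximum. -/
theorem isGreatest_maxPermArray (n d : ℕ) :
    IsGreatest {N : ℕ | ∃ P : Finset (Equiv.Perm (Fin n)), IsPermArrayWithDist n d P ∧ P.card = N}
      (maxPermArray n d) := by
  have hne : {N : ℕ | ∃ P : Finset (Equiv.Perm (Fin n)),
      IsPermArrayWithDist n d P ∧ P.card = N}.Nonempty :=
    ⟨_, {1}, ⟨Finset.singleton_nonempty _, by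
      intro σ hσ τ hτ h
      rw [Finset.mem_singleton] at hσ hτ
      exact absurd (hσ.trans hτ.symm) h⟩, rfl⟩
  have hbdd : BddAbove {N : ℕ | ∃ P : Finset (Equiv.Perm (Fin n)),
      IsPermArrayWithDist n d P ∧ P.card = N} := by
    refine ⟨Fintype.card (Equiv.Perm (Fin n)), ?_⟩
    rintro N ⟨P, -, rfl⟩
    exact Finset.card_le_univ P
  exact ⟨Nat.sSup_mem hne hbdd, fun N hN => le_csSup hbdd hN⟩

/-!
Let `X` be a finite set, `A ⊆ X` the complement of `m` symbols, and contract a permutation of `X` to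
`A` by taking its first-return map. Contraction can create agreements between two permutations `σ`
and `τ`. Each new agreement `x` needs a deleted symbol on the `σ`-path or on the `τ`-path from `x`
to its first return, and a deleted symbol lies on at most one path of each kind. This bounds the
loss of Hamming distance by `3m` (`hammingDist_le_contract_add_three_mul`).

A loss of more than `2m` forces an odd cycle: pick a smallest set `C` of new agreements that
outnumbers the suitably weighted set `S` of deleted symbols on its paths. By minimality every symbol
of `S` lies on paths of both kinds starting in `C`, and the weight of `S` is `C.card - 1`. Counting
then shows that `σ` and `τ` map `C ∪ S` onto the same set, so `τ⁻¹ * σ` permutes `C ∪ S`; the points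
it moves there are odd in number and at most `2m + 1`, so it has a cycle of odd length between `3`
and `2m + 1`. Hence the loss is at most `2m` if no such odd number divides the order of `τ⁻¹ * σ`
(`hammingDist_le_contract_add_two_mul`).

These bounds are applied to `AΓL(1, q)` acting on the field with `q = p ^ k` elements and to
`PΓL(2, q)` acting on its projective line, of orders `k q (q - 1)` and `k q (q - 1) (q + 1)`. The
fixed points of a nontrivial affine semilinear map are at most as many as the elements of a proper
subfield, hence at most `p ^ kstar` (`card_fixed_affine_le`). An element of `PΓL(2, q)` with a fixed
point is conjugate to an affine one, so it has at most `p ^ kstar + 1` fixed points and its order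
divides `k q (q - 1)` (`projective_fixed_point_bounds`). An element without fixed points may have an
order divisible by `3`, but there the full distance `q + 1` leaves room for a loss of `3m`.
-/

open Equiv

/-! ### First-return maps -/

section FirstReturn

variable {X : Type*}

/-- The number of steps after which the orbit of `x` under `σ` is in `A` again (`0`, by the
convention for `sInf ∅`, if it never is; this cannot happen for `x ∈ A`). -/
noncomputable def returnTime (σ : Perm X) (A : Finset X) (x : X) : ℕ :=
  sInf {j | 0 < j ∧ (σ ^ j) x ∈ A}

theorem returnTime_spec [Finite X] (σ : Perm X) {A : Finset X} {x : X} (hx : x ∈ A) :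
    0 < returnTime σ A x ∧ (σ ^ returnTime σ A x) x ∈ A := by
  have hne : {j | 0 < j ∧ (σ ^ j) x ∈ A}.Nonempty :=
    ⟨orderOf σ, orderOf_pos σ, by rw [pow_orderOf_eq_one]; exact hx⟩
  exact Nat.sInf_mem hne

theorem notMem_of_lt_returnTime {σ : Perm X} {A : Finset X} {x : X} {j : ℕ} (hj : 0 < j)
    (h : j < returnTime σ A x) : (σ ^ j) x ∉ A :=
  fun hA => Nat.notMem_of_lt_sInf h ⟨hj, hA⟩

/-- The first point of `A` that the orbit of `x` under `σ` meets after `x` itself. -/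
noncomputable def firstReturn (σ : Perm X) (A : Finset X) (x : X) : X :=
  (σ ^ returnTime σ A x) x

/-- `Visits σ A x z`: the orbit of `x` under `σ` passes through `z` strictly between `x` and its
first return to `A`. -/
def Visits (σ : Perm X) (A : Finset X) (x z : X) : Prop :=
  ∃ j, 0 < j ∧ j < returnTime σ A x ∧ (σ ^ j) x = z

/-- Two orbit segments that start in `A`, avoid `A` in between and end at the same point start at
the same point. -/
theorem eq_of_pow_eq_pow {σ : Perm X} {A : Finset X} {x x' : X} {j j' : ℕ} (hx : x ∈ A)
    (hx' : x' ∈ A) (hj : j ≤ returnTime σ A x) (hj' : j' ≤ returnTime σ A x') (hj0 : 0 < j)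
    (hj0' : 0 < j') (h : (σ ^ j) x = (σ ^ j') x') : x = x' := by
  wlog hle : j ≤ j' generalizing x x' j j'
  · exact (this hx' hx hj' hj hj0' hj0 h.symm (by omega)).symm
  obtain ⟨i, rfl⟩ := Nat.exists_eq_add_of_le hle
  rw [pow_add, Perm.mul_apply] at h
  have h1 : x = (σ ^ i) x' := (σ ^ j).injective h
  rcases Nat.eq_zero_or_pos i with rfl | hi
  · simpa using h1
  · exact absurd (h1 ▸ hx) (notMem_of_lt_returnTime hi (by omega))

theorem firstReturn_mem [Finite X] (σ : Perm X) {A : Finset X} {x : X} (hx : x ∈ A) :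
    firstReturn σ A x ∈ A := (returnTime_spec σ hx).2

theorem firstReturn_injOn [Finite X] (σ : Perm X) {A : Finset X} {x x' : X} (hx : x ∈ A) (hx' : x' ∈ A)
    (h : firstReturn σ A x = firstReturn σ A x') : x = x' :=
  eq_of_pow_eq_pow hx hx' le_rfl le_rfl (returnTime_spec σ hx).1 (returnTime_spec σ hx').1 h

theorem Visits.unique {σ : Perm X} {A : Finset X} {x x' z : X} (hx : x ∈ A) (hx' : x' ∈ A)
    (h : Visits σ A x z) (h' : Visits σ A x' z) : x = x' := by
  obtain ⟨j, hj, hjt, hz⟩ := h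
  obtain ⟨j', hj', hjt', hz'⟩ := h'
  exact eq_of_pow_eq_pow hx hx' hjt.le hjt'.le hj hj' (hz.trans hz'.symm)

theorem Visits.notMem {σ : Perm X} {A : Finset X} {x z : X} (h : Visits σ A x z) : z ∉ A := by
  obtain ⟨j, hj, hjt, rfl⟩ := h
  exact notMem_of_lt_returnTime hj hjt

theorem firstReturn_or_visits [Finite X] (σ : Perm X) {A : Finset X} {x : X} (hx : x ∈ A) :
    σ x = firstReturn σ A x ∨ Visits σ A x (σ x) := by
  rcases (Nat.succ_le_of_lt (returnTime_spec σ hx).1).eq_or_lt with h | h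
  · left; rw [firstReturn, ← h]; simp
  · right; exact ⟨1, one_pos, h, by simp⟩

theorem Visits.firstReturn_or_visits {σ : Perm X} {A : Finset X} {x z : X}
    (h : Visits σ A x z) : σ z = firstReturn σ A x ∨ Visits σ A x (σ z) := by
  obtain ⟨j, hj, hjt, rfl⟩ := h
  rw [← Perm.mul_apply, ← pow_succ']
  rcases (Nat.succ_le_of_lt hjt).eq_or_lt with h | h
  · left; rw [firstReturn, ← h]
  · right; exact ⟨j + 1, j.succ_pos, h, rfl⟩

/-- The contraction of `σ` to `A`: the first-return map as a permutation of `A`. In cycle notation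
it is `σ` with the symbols outside `A` deleted. -/
noncomputable def contract [Finite X] (σ : Perm X) (A : Finset X) : Perm A :=
  Equiv.ofBijective (fun x => ⟨firstReturn σ A x, firstReturn_mem σ x.2⟩)
    (Finite.injective_iff_bijective.1 fun x y h =>
      Subtype.ext (firstReturn_injOn σ x.2 y.2 (congrArg Subtype.val h)))

theorem coe_contract [Finite X] (σ : Perm X) (A : Finset X) (x : A) :
    (contract σ A x : X) = firstReturn σ A x := rfl

end FirstReturn

/-! ### Loss of Hamming distance under contraction -/

section Loss

variable {X : Type*}

/-- A weighted Hall-type extremal argument. If the points of `N` outnumber the total weight of `R`,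
then a smallest `C ⊆ N` outnumbering the weight of its neighbourhood `S` exceeds that weight by
exactly one, and every element of `S` has two different neighbours in `C`, hence one through each
of the two relations, both of which are injective towards `N`. -/
theorem exists_critical_subset {N R : Finset X} {u v : X → X → Prop} {w : X → ℕ}
    (hw : ∀ r ∈ R, 0 < w r)
    (hu : ∀ x ∈ N, ∀ x' ∈ N, ∀ r, u x r → u x' r → x = x')
    (hv : ∀ x ∈ N, ∀ x' ∈ N, ∀ r, v x r → v x' r → x = x')
    (h : ∑ r ∈ R, w r < N.card) :
    ∃ C ⊆ N, ∃ S ⊆ R, ∑ r ∈ S, w r + 1 = C.card ∧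
      (∀ r ∈ S, (∃ x ∈ C, u x r) ∧ ∃ x ∈ C, v x r) ∧
      ∀ r ∈ R, ∀ x ∈ C, u x r ∨ v x r → r ∈ S := by
  classical
  let nb : Finset X → Finset X := fun C => R.filter fun r => ∃ x ∈ C, u x r ∨ v x r
  let W : Finset X → ℕ := fun C => ∑ r ∈ nb C, w r
  have hWN : W N ≤ ∑ r ∈ R, w r := Finset.sum_le_sum_of_subset (Finset.filter_subset _ _)
  obtain ⟨C, hC, hmin⟩ := Finset.exists_min_image (N.powerset.filter fun C => W C < C.card)
    Finset.card ⟨N, by simpa using hWN.trans_lt h⟩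
  simp only [Finset.mem_filter, Finset.mem_powerset] at hC hmin
  obtain ⟨hCN, hCW⟩ := hC
  have key : ∀ x ∈ C, W (C.erase x) + 1 = C.card ∧ nb (C.erase x) = nb C ∧
      W C + 1 = C.card := by
    intro x hx
    have hsub : nb (C.erase x) ⊆ nb C := by
      intro r hr
      simp only [nb, Finset.mem_filter] at hr ⊢
      obtain ⟨hr, y, hy, hyr⟩ := hr
      exact ⟨hr, y, Finset.mem_of_mem_erase hy, hyr⟩
    have hcard := Finset.card_erase_add_one hx
    have h1 : ¬ W (C.erase x) < (C.erase x).card := fun hlt => by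
      have := hmin _ ⟨(Finset.erase_subset _ _).trans hCN, hlt⟩
      omega
    have h2 : W (C.erase x) ≤ W C := Finset.sum_le_sum_of_subset hsub
    refine ⟨by omega, ?_, by omega⟩
    by_contra hne
    obtain ⟨r, hr, hr'⟩ := Finset.exists_of_ssubset (hsub.ssubset_of_ne hne)
    have : W (C.erase x) < W C :=
      Finset.sum_lt_sum_of_subset hsub hr hr' (hw r (Finset.mem_filter.1 hr).1)
        fun _ _ _ => Nat.zero_le _
    omega
  have hCne : C.Nonempty := Finset.card_pos.1 (by omega)
  have other : ∀ r ∈ nb C, ∀ x ∈ C, ∃ y ∈ C, y ≠ x ∧ (u y r ∨ v y r) := by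
    intro r hr x hx
    rw [← (key x hx).2.1] at hr
    obtain ⟨-, y, hy, hyr⟩ := Finset.mem_filter.1 hr
    exact ⟨y, Finset.mem_of_mem_erase hy, Finset.ne_of_mem_erase hy, hyr⟩
  refine ⟨C, hCN, nb C, Finset.filter_subset _ _, (key _ hCne.choose_spec).2.2, ?_, ?_⟩
  · intro r hr
    obtain ⟨-, x, hx, hxr⟩ := Finset.mem_filter.1 hr
    obtain ⟨y, hy, hyx, hyr⟩ := other r hr x hx
    rcases hxr with hxr | hxr <;> rcases hyr with hyr | hyr
    · exact absurd (hu _ (hCN hy) _ (hCN hx) r hyr hxr) hyx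
    · exact ⟨⟨x, hx, hxr⟩, y, hy, hyr⟩
    · exact ⟨⟨y, hy, hyr⟩, x, hx, hxr⟩
    · exact absurd (hv _ (hCN hy) _ (hCN hx) r hyr hxr) hyx
  · intro r hr x hx hxr
    exact Finset.mem_filter.2 ⟨hr, x, hx, hxr⟩

/-- An invariant set of odd size without fixed points contains a cycle of odd length. -/
theorem exists_odd_dvd_orderOf [DecidableEq X] {π : Perm X} {D : Finset X} (hD : ∀ x ∈ D, π x ∈ D)
    (hfix : ∀ x ∈ D, π x ≠ x) (hodd : Odd D.card) :
    ∃ i, 1 ≤ i ∧ 2 * i + 1 ≤ D.card ∧ 2 * i + 1 ∣ orderOf π := by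
  have himg : D.image π = D :=
    Finset.eq_of_subset_of_card_le (Finset.image_subset_iff.2 hD)
      (Finset.card_image_of_injective _ π.injective).ge
  have hiff : ∀ x, π x ∈ D ↔ x ∈ D := fun x => by
    conv_lhs => rw [← himg]
    exact π.injective.mem_finset_image
  let ρ : Perm {x // x ∈ D} := π.subtypePerm hiff
  have hsupp : ρ.support = Finset.univ := by
    ext x
    simpa [ρ, Subtype.ext_iff] using hfix x x.2
  have hsum : ρ.cycleType.sum = D.card := by
    rw [Perm.sum_cycleType, hsupp]; simp
  have hord : orderOf ρ ∣ orderOf π := by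
    apply orderOf_dvd_of_pow_eq_one
    ext x
    simp [ρ, Perm.subtypePerm_pow, pow_orderOf_eq_one]
  obtain ⟨l, hl, hlodd⟩ : ∃ l ∈ ρ.cycleType, Odd l := by
    by_contra! hne
    have : 2 ∣ ρ.cycleType.sum :=
      Multiset.dvd_sum fun l hl => (Nat.not_odd_iff_even.1 (hne l hl)).two_dvd
    rw [hsum] at this
    exact (Nat.not_even_iff_odd.2 hodd) (even_iff_two_dvd.2 this)
  obtain ⟨i, rfl⟩ := hlodd
  have h2 := Perm.two_le_of_mem_cycleType hl
  exact ⟨i, by omega, hsum ▸ Multiset.le_sum_of_mem hl,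
    (Perm.dvd_of_mem_cycleType hl).trans hord⟩

variable [Fintype X] [DecidableEq X]

/-- The symbols of `A` at which the contractions of `σ` and `τ` agree but `σ` and `τ` do not. -/
noncomputable def newAgreements (σ τ : Perm X) (A : Finset X) : Finset X :=
  A.filter fun x => σ x ≠ τ x ∧ firstReturn σ A x = firstReturn τ A x

theorem hammingDist_contract (σ τ : Perm X) (A : Finset X) :
    hammingDist (contract σ A) (contract τ A) =
      (A.filter fun x => firstReturn σ A x ≠ firstReturn τ A x).card := by
  rw [hammingDist, ← Finset.card_map (Function.Embedding.subtype _)]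
  congr 1
  ext x
  simp only [Finset.mem_map, Finset.mem_filter, Finset.mem_univ, true_and, ne_eq,
    Function.Embedding.subtype_apply, Subtype.ext_iff, coe_contract]
  constructor
  · rintro ⟨y, hy, rfl⟩; exact ⟨y.2, hy⟩
  · rintro ⟨hx, hy⟩; exact ⟨⟨x, hx⟩, hy, rfl⟩

theorem hammingDist_le_contract_add (σ τ : Perm X) (A : Finset X) :
    hammingDist σ τ ≤ hammingDist (contract σ A) (contract τ A) + (newAgreements σ τ A).card +
      (Aᶜ.filter fun r => σ r ≠ τ r).card := by
  rw [hammingDist_contract, hammingDist]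
  refine (Finset.card_le_card ?_).trans ((Finset.card_union_le _ _).trans
    (Nat.add_le_add_right (Finset.card_union_le _ _) _))
  intro x hx
  simp only [newAgreements, Finset.mem_union, Finset.mem_filter, Finset.mem_compl,
    Finset.mem_univ, true_and] at hx ⊢
  tauto

theorem exists_visits_of_mem_newAgreements {σ τ : Perm X} {A : Finset X} {x : X}
    (hx : x ∈ newAgreements σ τ A) : (∃ r, Visits σ A x r) ∨ ∃ r, Visits τ A x r := by
  obtain ⟨hA, hne, heq⟩ := Finset.mem_filter.1 hx
  rcases firstReturn_or_visits σ hA with h | h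
  · rcases firstReturn_or_visits τ hA with h' | h'
    · exact absurd (h.trans (heq.trans h'.symm)) hne
    · exact Or.inr ⟨_, h'⟩
  · exact Or.inl ⟨_, h⟩

/-- Each new agreement uses up a deleted symbol for `σ` or one for `τ`. -/
theorem card_newAgreements_le_two_mul (σ τ : Perm X) (A : Finset X) :
    (newAgreements σ τ A).card ≤ 2 * Aᶜ.card := by
  classical
  have hN : newAgreements σ τ A ⊆ A := Finset.filter_subset _ _
  have hbd : ∀ ρ : Perm X, ((newAgreements σ τ A).filter fun x => ∃ r, Visits ρ A x r).card ≤
      Aᶜ.card := by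
    intro ρ
    have hsel : ∀ x ∈ (newAgreements σ τ A).filter fun x => ∃ r, Visits ρ A x r,
        ∃ r ∈ Aᶜ, Visits ρ A x r := by
      intro x hx
      obtain ⟨r, hr⟩ := (Finset.mem_filter.1 hx).2
      exact ⟨r, Finset.mem_compl.2 hr.notMem, hr⟩
    choose! f hf hfv using hsel
    refine Finset.card_le_card_of_injOn f hf fun x hx y hy hxy => ?_
    exact (hfv x hx).unique (hN (Finset.mem_filter.1 hx).1) (hN (Finset.mem_filter.1 hy).1)
      (hxy ▸ hfv y hy)
  have hcov : newAgreements σ τ A ⊆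
      ((newAgreements σ τ A).filter fun x => ∃ r, Visits σ A x r) ∪
        (newAgreements σ τ A).filter fun x => ∃ r, Visits τ A x r := by
    intro x hx
    rw [Finset.mem_union, Finset.mem_filter, Finset.mem_filter]
    exact (exists_visits_of_mem_newAgreements hx).imp (⟨hx, ·⟩) (⟨hx, ·⟩)
  calc _ ≤ _ := Finset.card_le_card hcov
    _ ≤ _ := Finset.card_union_le _ _
    _ ≤ 2 * Aᶜ.card := by have := hbd σ; have := hbd τ; omega

/-- If the order of `τ⁻¹ * σ` has no odd divisor `3, 5, …, 2m + 1`, where `m` symbols are deleted,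
then the new agreements cost at most one for every deleted symbol at which `σ` and `τ` differ, and
two for every other deleted symbol. -/
theorem card_newAgreements_le_sum {σ τ : Perm X} {A : Finset X}
    (hord : ∀ i ∈ Finset.Icc 1 Aᶜ.card, ¬ 2 * i + 1 ∣ orderOf (τ⁻¹ * σ)) :
    (newAgreements σ τ A).card ≤ ∑ r ∈ Aᶜ, if σ r ≠ τ r then 1 else 2 := by
  classical
  by_contra! hlt
  have hNA : newAgreements σ τ A ⊆ A := Finset.filter_subset _ _
  obtain ⟨C, hCN, S, hSR, hcard, hS, hcl⟩ := exists_critical_subset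
    (u := Visits σ A) (v := Visits τ A) (fun r _ => by split_ifs <;> norm_num)
    (fun x hx x' hx' r h h' => h.unique (hNA hx) (hNA hx') h')
    (fun x hx x' hx' r h h' => h.unique (hNA hx) (hNA hx') h') hlt
  have hCA : C ⊆ A := hCN.trans hNA
  have hCS : ∀ T ⊆ S, Disjoint C T := fun T hT => Finset.disjoint_left.2 fun x hx hxT =>
    Finset.mem_compl.1 (hSR (hT hxT)) (hCA hx)
  -- Both `σ` and `τ` map `C ∪ S` onto `S ∪ Y`, with `Y` the common first returns from `C`.
  set Y := C.image (firstReturn σ A) with hY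
  have hYτ : ∀ x ∈ C, firstReturn τ A x ∈ Y := fun x hx =>
    Finset.mem_image.2 ⟨x, hx, (Finset.mem_filter.1 (hCN hx)).2.2⟩
  have hmaps : ∀ ρ : Perm X, (∀ x ∈ C, firstReturn ρ A x ∈ Y) →
      (∀ r ∈ S, ∃ x ∈ C, Visits ρ A x r) → (∀ r ∈ Aᶜ, ∀ x ∈ C, Visits ρ A x r → r ∈ S) →
      (C ∪ S).image ρ = S ∪ Y := by
    intro ρ hρY hρS hρcl
    refine Finset.eq_of_subset_of_card_le (Finset.image_subset_iff.2 fun z hz => ?_) ?_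
    · have hz' : ∃ x ∈ C, ρ z = firstReturn ρ A x ∨ Visits ρ A x (ρ z) := by
        rcases Finset.mem_union.1 hz with hz | hz
        · exact ⟨z, hz, firstReturn_or_visits ρ (hCA hz)⟩
        · obtain ⟨x, hx, hxz⟩ := hρS z hz
          exact ⟨x, hx, hxz.firstReturn_or_visits⟩
      obtain ⟨x, hx, h | h⟩ := hz'
      · exact Finset.mem_union_right _ (h ▸ hρY x hx)
      · exact Finset.mem_union_left _ (hρcl _ (Finset.mem_compl.2 h.notMem) x hx h)
    · rw [Finset.card_image_of_injective _ ρ.injective, Finset.card_union_of_disjoint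
        (hCS S subset_rfl)]
      have h1 := Finset.card_union_le S Y
      have h2 : Y.card ≤ C.card := Finset.card_image_le
      omega
  have hσ := hmaps σ (fun x hx => Finset.mem_image_of_mem _ hx) (fun r hr => (hS r hr).1)
    fun r hr x hx h => hcl r hr x hx (Or.inl h)
  have hτ := hmaps τ hYτ (fun r hr => (hS r hr).2) fun r hr x hx h => hcl r hr x hx (Or.inr h)
  have hinv : ∀ x ∈ C ∪ S, (τ⁻¹ * σ) x ∈ C ∪ S := by
    intro x hx
    have h1 : σ x ∈ (C ∪ S).image τ := by
      rw [hτ, ← hσ]; exact Finset.mem_image_of_mem _ hx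
    obtain ⟨y, hy, hyx⟩ := Finset.mem_image.1 h1
    simpa [← hyx] using hy
  -- The weights are chosen so that discarding the fixed points leaves an odd number of points.
  set D := C ∪ S.filter fun r => σ r ≠ τ r with hDdef
  have hDcard : D.card = C.card + (S.filter fun r => σ r ≠ τ r).card :=
    Finset.card_union_of_disjoint (hCS _ (Finset.filter_subset _ _))
  have hsum : ∑ r ∈ S, (if σ r ≠ τ r then 1 else 2) =
      (S.filter fun r => σ r ≠ τ r).card + 2 * (S.filter fun r => ¬ σ r ≠ τ r).card := by
    rw [Finset.sum_ite]; simp [mul_comm]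
  have hfilt := Finset.card_filter_add_card_filter_not (s := S) (fun r => σ r ≠ τ r)
  have hScard : S.card ≤ Aᶜ.card := Finset.card_le_card hSR
  have hDmem : ∀ x, x ∈ D ↔ x ∈ C ∪ S ∧ σ x ≠ τ x := by
    intro x
    simp only [hDdef, Finset.mem_union, Finset.mem_filter]
    constructor
    · rintro (h | h)
      · exact ⟨Or.inl h, (Finset.mem_filter.1 (hCN h)).2.1⟩
      · exact ⟨Or.inr h.1, h.2⟩
    · rintro ⟨h | h, h'⟩
      · exact Or.inl h
      · exact Or.inr ⟨h, h'⟩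
  have hfix : ∀ x, (τ⁻¹ * σ) x = x ↔ σ x = τ x := fun x => by
    rw [Perm.mul_apply, Perm.inv_eq_iff_eq]
  obtain ⟨i, hi, hile, hdvd⟩ := exists_odd_dvd_orderOf (π := τ⁻¹ * σ) (D := D)
    (fun x hx => by
      rw [hDmem] at hx ⊢
      refine ⟨hinv x hx.1, fun h => hx.2 ?_⟩
      rw [← hfix] at h ⊢
      exact (τ⁻¹ * σ).injective h)
    (fun x hx => by rw [Ne, hfix]; exact ((hDmem x).1 hx).2)
    ⟨(S.filter fun r => σ r ≠ τ r).card + (S.filter fun r => ¬ σ r ≠ τ r).card, by omega⟩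
  exact hord i (Finset.mem_Icc.2 ⟨hi, by omega⟩) hdvd

theorem hammingDist_le_contract_add_three_mul (σ τ : Perm X) (A : Finset X) :
    hammingDist σ τ ≤ hammingDist (contract σ A) (contract τ A) + 3 * Aᶜ.card := by
  have h1 := hammingDist_le_contract_add σ τ A
  have h2 := card_newAgreements_le_two_mul σ τ A
  have h3 : (Aᶜ.filter fun r => σ r ≠ τ r).card ≤ Aᶜ.card := Finset.card_filter_le _ _
  omega

theorem hammingDist_le_contract_add_two_mul {σ τ : Perm X} {A : Finset X}
    (hord : ∀ i ∈ Finset.Icc 1 Aᶜ.card, ¬ 2 * i + 1 ∣ orderOf (τ⁻¹ * σ)) :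
    hammingDist σ τ ≤ hammingDist (contract σ A) (contract τ A) + 2 * Aᶜ.card := by
  have h1 := hammingDist_le_contract_add σ τ A
  have h2 := card_newAgreements_le_sum hord
  have hfilt := Finset.card_filter_add_card_filter_not (s := Aᶜ) (fun r => σ r ≠ τ r)
  have hsum : ∑ r ∈ Aᶜ, (if σ r ≠ τ r then 1 else 2) =
      (Aᶜ.filter fun r => σ r ≠ τ r).card + 2 * (Aᶜ.filter fun r => ¬ σ r ≠ τ r).card := by
    rw [Finset.sum_ite]; simp [mul_comm]
  omega

/-- Permutations whose contractions to `A` are pairwise at distance at least `d > 0` form, after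
contraction, a permutation array of the same size on `A.card` symbols. -/
theorem card_le_maxPermArray {G : Finset (Perm X)} (hG : G.Nonempty) {A : Finset X} {n d : ℕ}
    (hA : A.card = n) (hd : 0 < d)
    (h : ∀ σ ∈ G, ∀ τ ∈ G, σ ≠ τ → d ≤ hammingDist (contract σ A) (contract τ A)) :
    G.card ≤ maxPermArray n d := by
  classical
  let e : A ≃ Fin n := Finset.equivFinOfCardEq hA
  have hdist : ∀ f g : Perm A, hammingDist (e.permCongr f) (e.permCongr g) = hammingDist f g := by
    intro f g
    refine Finset.card_equiv e.symm fun i => ?_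
    simp [Equiv.permCongr_apply]
  have hinj : Set.InjOn (fun σ => e.permCongr (contract σ A)) (G : Set (Perm X)) := by
    intro σ hσ τ hτ heq
    by_contra hne
    have h1 := h σ hσ τ hτ hne
    rw [e.permCongr.injective heq, hammingDist_self] at h1
    omega
  refine (isGreatest_maxPermArray n d).2
    ⟨G.image fun σ => e.permCongr (contract σ A), ⟨hG.image _, ?_⟩,
      Finset.card_image_of_injOn hinj⟩
  intro f hf g hg hfg
  obtain ⟨σ, hσ, rfl⟩ := Finset.mem_image.1 hf
  obtain ⟨τ, hτ, rfl⟩ := Finset.mem_image.1 hg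
  rw [hdist]
  exact h σ hσ τ hτ fun heq => hfg (by rw [heq])

end Loss

theorem hammingDist_add_card_fixed {X : Type*} [Fintype X] [DecidableEq X] (σ τ : Perm X) :
    hammingDist σ τ + (Finset.univ.filter fun x => (τ⁻¹ * σ) x = x).card = Fintype.card X := by
  have h := Finset.card_filter_add_card_filter_not (s := Finset.univ) fun x : X => σ x ≠ τ x
  simp only [not_not, Finset.card_univ] at h
  rw [← h, hammingDist]
  simp only [Perm.mul_apply, Perm.inv_eq_iff_eq]

/-- Deleting `m` symbols from a permutation group. Elements with few fixed points may lose three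
units of distance per deleted symbol; the others have to satisfy the condition on orders that
limits the loss to two. -/
theorem card_subgroup_le_maxPermArray {X : Type*} [Fintype X] [DecidableEq X]
    (G : Subgroup (Perm X)) {m d : ℕ} (hm : m ≤ Fintype.card X) (hd : 0 < d)
    (h : ∀ π ∈ G, π ≠ 1 →
      d + 3 * m + (Finset.univ.filter fun x => π x = x).card ≤ Fintype.card X ∨
      d + 2 * m + (Finset.univ.filter fun x => π x = x).card ≤ Fintype.card X ∧
        ∀ i ∈ Finset.Icc 1 m, ¬ 2 * i + 1 ∣ orderOf π) :
    Nat.card G ≤ maxPermArray (Fintype.card X - m) d := by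
  classical
  obtain ⟨A, -, hA⟩ := Finset.exists_subset_card_eq
    (s := (Finset.univ : Finset X)) (n := Fintype.card X - m) (by simp)
  have hAc : Aᶜ.card = m := by rw [Finset.card_compl]; omega
  have hmem : ∀ σ, σ ∈ (Finset.univ.filter fun σ : Perm X => σ ∈ G) ↔ σ ∈ G := by simp
  have hcard : Nat.card G = (Finset.univ.filter fun σ : Perm X => σ ∈ G).card := by
    rw [Nat.card_eq_fintype_card, Fintype.card_subtype]
  rw [hcard]
  refine card_le_maxPermArray ⟨1, (hmem 1).2 G.one_mem⟩ hA hd fun σ hσ τ hτ hne => ?_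
  rw [hmem] at hσ hτ
  have hfix := hammingDist_add_card_fixed σ τ
  rcases h (τ⁻¹ * σ) (G.mul_mem (G.inv_mem hτ) hσ)
    (fun h1 => hne (inv_mul_eq_one.1 h1).symm) with h1 | ⟨h1, h2⟩
  · have := hammingDist_le_contract_add_three_mul σ τ A
    omega
  · have := hammingDist_le_contract_add_two_mul (A := A) (hAc.symm ▸ h2)
    omega

/-! ### The affine semilinear group of the line -/

section Affine

variable (K F : Type*) [Field K] [Field F] [Algebra K F]

/-- The group `AΓL(1, F)` over the base field `K`: the permutations `x ↦ a φ(x) + b` of `F`, with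
`a ≠ 0` and `φ` an automorphism of `F` over `K`. -/
def affineSemilinearGroup : Subgroup (Perm F) where
  carrier := {f | ∃ (a : Fˣ) (φ : F ≃ₐ[K] F) (b : F), ∀ x, f x = a * φ x + b}
  one_mem' := ⟨1, 1, 0, fun x => by simp⟩
  mul_mem' := by
    rintro f g ⟨a, φ, b, hf⟩ ⟨a', φ', b', hg⟩
    refine ⟨a * Units.map (φ : F →* F) a', φ * φ', a * φ b' + b, fun x => ?_⟩
    simp only [Perm.mul_apply, hf, hg, map_add, map_mul, Units.val_mul, Units.coe_map,
      AlgEquiv.mul_apply, MonoidHom.coe_coe]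
    ring
  inv_mem' := by
    rintro f ⟨a, φ, b, hf⟩
    refine ⟨(Units.map (φ.symm : F →* F) a)⁻¹, φ.symm,
      -((Units.map (φ.symm : F →* F) a)⁻¹ : Fˣ) * φ.symm b, fun x => ?_⟩
    rw [Perm.inv_eq_iff_eq, hf]
    simp only [map_add, map_mul, map_neg, Units.val_inv_eq_inv_val, Units.coe_map,
      MonoidHom.coe_coe, map_inv₀, AlgEquiv.apply_symm_apply]
    field_simp
    ring

variable {K F}

theorem exists_mem_affineSemilinearGroup (a : Fˣ) (φ : F ≃ₐ[K] F) (b : F) :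
    ∃ f ∈ affineSemilinearGroup K F, ∀ x, f x = a * φ x + b :=
  ⟨φ.toEquiv.trans (a.mulLeft.trans (Equiv.addRight b)), ⟨a, φ, b, fun _ => rfl⟩, fun _ => rfl⟩

theorem card_affineSemilinearGroup [Finite K] [Fintype F] :
    Nat.card (affineSemilinearGroup K F) =
      Module.finrank K F * Fintype.card F * (Fintype.card F - 1) := by
  classical
  choose s hs hsx using exists_mem_affineSemilinearGroup (K := K) (F := F)
  have hbij : Function.Bijective
      (fun t : (F ≃ₐ[K] F) × F × Fˣ =>
        (⟨s t.2.2 t.1 t.2.1, hs _ _ _⟩ : affineSemilinearGroup K F)) := by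
    constructor
    · rintro ⟨φ, b, a⟩ ⟨φ', b', a'⟩ h
      have hx : ∀ x, a * φ x + b = a' * φ' x + b' := fun x => by
        rw [← hsx, ← hsx]; exact DFunLike.congr_fun (congrArg Subtype.val h) x
      have hb : b = b' := by simpa using hx 0
      subst hb
      have ha : a = a' := Units.ext (by simpa using hx 1)
      subst ha
      have hφ : φ = φ' := AlgEquiv.ext fun x => by simpa using hx x
      rw [hφ]
    · rintro ⟨f, a, φ, b, hf⟩
      exact ⟨(φ, b, a), Subtype.ext (Equiv.ext fun x => (hsx _ _ _ x).trans (hf x).symm)⟩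
  rw [← Nat.card_congr (Equiv.ofBijective _ hbij), Nat.card_prod, Nat.card_prod,
    IsGalois.card_aut_eq_finrank, Nat.card_eq_fintype_card, Nat.card_eq_fintype_card,
    Fintype.card_units, mul_assoc]

/-- The fixed field of a nontrivial automorphism is a proper intermediate field, so its degree over
`K` is a proper divisor of the degree of `F`. -/
theorem card_fixed_algEquiv_le [Fintype K] [Fintype F] [DecidableEq F] {e : ℕ}
    (he : ∀ d ∈ (Module.finrank K F).properDivisors, d ≤ e) {φ : F ≃ₐ[K] F} (hφ : φ ≠ 1) :
    (Finset.univ.filter fun x => φ x = x).card ≤ Fintype.card K ^ e := by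
  classical
  let L : IntermediateField K F := IntermediateField.fixedField (Subgroup.zpowers φ)
  have hL : ∀ x, x ∈ L ↔ φ x = x := by
    intro x
    rw [IntermediateField.mem_fixedField_iff]
    refine ⟨fun h => h φ (Subgroup.mem_zpowers φ), fun h f hf => ?_⟩
    have : Subgroup.zpowers φ ≤ MulAction.stabilizer (F ≃ₐ[K] F) x := by
      rw [Subgroup.zpowers_le]; exact h
    exact this hf
  have hcard : (Finset.univ.filter fun x => φ x = x).card = Fintype.card L := by
    rw [Fintype.card_subtype]
    simp only [hL]
  rw [hcard, Module.card_eq_pow_finrank (K := K) (V := L)]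
  have hmul := Module.finrank_mul_finrank K L F
  refine Nat.pow_le_pow_right Fintype.card_pos (he _ (Nat.mem_properDivisors.2
    ⟨⟨_, hmul.symm⟩, ?_⟩))
  refine lt_of_le_of_ne (Nat.le_of_dvd Module.finrank_pos ⟨_, hmul.symm⟩) fun heq => hφ ?_
  have htop : L = ⊤ := IntermediateField.eq_of_le_of_finrank_eq le_top
    (heq.trans IntermediateField.finrank_top'.symm)
  ext x
  exact (hL x).1 (htop ▸ IntermediateField.mem_top)

/-- Normalised at one fixed point and one fixed difference, the fixed points of `x ↦ a φ(x) + b`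
become fixed points of `φ`. -/
theorem card_fixed_affine_le [Fintype K] [Fintype F] [DecidableEq F] {e : ℕ}
    (he : ∀ d ∈ (Module.finrank K F).properDivisors, d ≤ e) {f : Perm F}
    (hf : f ∈ affineSemilinearGroup K F) (hf1 : f ≠ 1) :
    (Finset.univ.filter fun x => f x = x).card ≤ Fintype.card K ^ e := by
  obtain ⟨a, φ, b, hfx⟩ := hf
  have hpos : 1 ≤ Fintype.card K ^ e := Nat.one_le_pow _ _ Fintype.card_pos
  rcases le_or_gt (Finset.univ.filter fun x => f x = x).card 1 with hle | hlt
  · exact hle.trans hpos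
  obtain ⟨x₀, h₀, x₁, h₁, hne⟩ := Finset.one_lt_card.1 hlt
  simp only [Finset.mem_filter, Finset.mem_univ, true_and, hfx] at h₀ h₁
  have hsub : x₁ - x₀ ≠ 0 := sub_ne_zero.2 hne.symm
  have hlin : a * φ (x₁ - x₀) = x₁ - x₀ := by
    rw [map_sub]; linear_combination h₁ - h₀
  have hnorm : ∀ x, f x = x → φ ((x - x₀) / (x₁ - x₀)) = (x - x₀) / (x₁ - x₀) := by
    intro x hx
    rw [hfx] at hx
    have hxl : a * φ (x - x₀) = x - x₀ := by
      rw [map_sub]; linear_combination hx - h₀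
    rw [map_div₀, ← mul_div_mul_left _ _ a.ne_zero, hxl, hlin]
  have hφ : φ ≠ 1 := by
    rintro rfl
    simp only [AlgEquiv.one_apply] at hlin h₀
    have ha : (a : F) = 1 := mul_right_cancel₀ hsub (hlin.trans (one_mul _).symm)
    refine hf1 (Equiv.ext fun x => ?_)
    rw [ha, one_mul, add_eq_left] at h₀
    simp [hfx, ha, h₀]
  refine le_trans (Finset.card_le_card_of_injOn (fun x => (x - x₀) / (x₁ - x₀)) ?_ ?_)
    (card_fixed_algEquiv_le he hφ)
  · intro x hx
    simpa using hnorm x (by simpa using hx)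
  · intro x _ y _ hxy
    simpa [div_left_inj' hsub] using hxy

end Affine

/-! ### The projective semilinear group of the projective line -/

section Projective

variable (K F : Type*) [Field K] [Field F] [Algebra K F] [DecidableEq F]

open OnePoint

/-- The group `PΓL(2, F)` over the base field `K`: the permutations of the projective line
`F ∪ {∞}` obtained by applying an automorphism of `F` over `K` and then a Möbius transformation. -/
def projectiveSemilinearGroup : Subgroup (Perm (OnePoint F)) where
  carrier := {g | ∃ (M : GL (Fin 2) F) (φ : F ≃ₐ[K] F), ∀ x, g x = M • OnePoint.map φ x}
  one_mem' := ⟨1, 1, fun x => by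
    rw [one_smul]; exact (congrFun OnePoint.map_id x).symm⟩
  mul_mem' := by
    rintro f g ⟨M, φ, hf⟩ ⟨N, ψ, hg⟩
    refine ⟨M * N.map (φ : F →+* F), φ * ψ, fun x => ?_⟩
    rw [Perm.mul_apply, hf, hg, mul_smul]
    congr 1
    refine (OnePoint.map_smul (φ : F →+* F) N _).trans ?_
    congr 1
    cases x <;> rfl
  inv_mem' := by
    rintro f ⟨M, φ, hf⟩
    refine ⟨(M⁻¹).map (φ.symm : F →+* F), φ.symm, fun x => ?_⟩
    have h := OnePoint.map_smul (φ.symm : F →+* F) M⁻¹ x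
    rw [Perm.inv_eq_iff_eq, hf]
    refine Eq.trans ?_ (congrArg (fun y => M • OnePoint.map φ y) h)
    have hcancel : ∀ y : OnePoint F,
        OnePoint.map φ (OnePoint.map (φ.symm : F →+* F) y) = y := by
      intro y
      cases y with
      | infty => rfl
      | coe c => exact congrArg OnePoint.some (φ.apply_symm_apply c)
    rw [hcancel, smul_inv_smul]

variable {K F}

theorem exists_mem_projectiveSemilinearGroup (M : GL (Fin 2) F) (φ : F ≃ₐ[K] F) :
    ∃ g ∈ projectiveSemilinearGroup K F, ∀ x, g x = M • OnePoint.map φ x := by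
  have hl : ∀ (ψ χ : F ≃ₐ[K] F), (∀ c, χ (ψ c) = c) →
      Function.LeftInverse (OnePoint.map χ) (OnePoint.map ψ) := by
    intro ψ χ h x
    cases x with
    | infty => rfl
    | coe c => exact congrArg OnePoint.some (h c)
  let e : Perm (OnePoint F) :=
    ⟨OnePoint.map φ, OnePoint.map φ.symm, hl _ _ φ.symm_apply_apply, hl _ _ φ.apply_symm_apply⟩
  exact ⟨MulAction.toPerm M * e, ⟨M, φ, fun _ => rfl⟩, fun _ => rfl⟩

theorem exists_affine_of_apply_infty {g : Perm (OnePoint F)}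
    (hg : g ∈ projectiveSemilinearGroup K F) (h : g ∞ = ∞) :
    ∃ f ∈ affineSemilinearGroup K F, ∀ x : F, g x = (f x : F) := by
  obtain ⟨M, φ, hM⟩ := hg
  have h10 : M 1 0 = 0 := by
    rw [hM] at h; exact smul_infty_eq_self_iff.1 h
  have hdet : M 0 0 * M 1 1 ≠ 0 := by
    have := M.det_ne_zero
    rwa [Matrix.det_fin_two, h10, mul_zero, sub_zero] at this
  have h00 := left_ne_zero_of_mul hdet
  have h11 := right_ne_zero_of_mul hdet
  obtain ⟨f, hf, hfx⟩ := exists_mem_affineSemilinearGroup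
    (Units.mk0 (M 0 0 / M 1 1) (div_ne_zero h00 h11)) φ (M 0 1 / M 1 1)
  refine ⟨f, hf, fun x => ?_⟩
  rw [hM, hfx, OnePoint.map_some, smul_some_eq_ite, h10, zero_mul, zero_add, if_neg h11]
  congr 1
  simp only [Units.val_mk0]
  ring

theorem exists_projective_of_affine {f : Perm F} (hf : f ∈ affineSemilinearGroup K F) :
    ∃ g ∈ projectiveSemilinearGroup K F, g ∞ = ∞ ∧ ∀ x : F, g x = (f x : F) := by
  obtain ⟨a, φ, b, hfx⟩ := hf
  obtain ⟨g, hg, hgx⟩ := exists_mem_projectiveSemilinearGroup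
    (Matrix.GeneralLinearGroup.mkOfDetNeZero !![(a : F), b; 0, 1] (by simp)) φ
  refine ⟨g, hg, ?_, fun x => ?_⟩
  · rw [hgx]
    exact smul_infty_eq_self_iff.2 (by simp [Matrix.GeneralLinearGroup.mkOfDetNeZero])
  · rw [hgx, hfx, OnePoint.map_some, smul_some_eq_ite]
    simp [Matrix.GeneralLinearGroup.mkOfDetNeZero]

theorem card_stabilizer_infty :
    Nat.card (MulAction.stabilizer (projectiveSemilinearGroup K F) (∞ : OnePoint F)) =
      Nat.card (affineSemilinearGroup K F) := by
  have h : ∀ g : MulAction.stabilizer (projectiveSemilinearGroup K F) (∞ : OnePoint F),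
      ∃ f : affineSemilinearGroup K F, ∀ x : F, g.1.1 x = (f.1 x : F) := fun g => by
    obtain ⟨f, hf, hfx⟩ := exists_affine_of_apply_infty g.1.2 g.2
    exact ⟨⟨f, hf⟩, hfx⟩
  choose s hs using h
  refine Nat.card_congr (Equiv.ofBijective s ⟨fun g g' hgg => ?_, fun f => ?_⟩)
  · refine Subtype.ext (Subtype.ext (Equiv.ext fun x => ?_))
    cases x with
    | infty => exact (show g.1.1 ∞ = ∞ from g.2).trans (show g'.1.1 ∞ = ∞ from g'.2).symm
    | coe c => rw [hs, hs, hgg]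
  · obtain ⟨g, hg, hinf, hgx⟩ := exists_projective_of_affine f.2
    refine ⟨⟨⟨g, hg⟩, hinf⟩, Subtype.ext (Equiv.ext fun x => ?_)⟩
    have := hs ⟨⟨g, hg⟩, hinf⟩ x
    exact OnePoint.coe_injective (this.symm.trans (hgx x))

theorem exists_apply_infty_eq (y : OnePoint F) :
    ∃ h ∈ projectiveSemilinearGroup K F, h ∞ = y := by
  cases y with
  | infty => exact ⟨1, one_mem _, rfl⟩
  | coe c =>
    obtain ⟨g, hg, hgx⟩ := exists_mem_projectiveSemilinearGroup (K := K)
      (Matrix.GeneralLinearGroup.mkOfDetNeZero !![c, 1; 1, 0] (by simp)) 1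
    refine ⟨g, hg, ?_⟩
    rw [hgx, OnePoint.map_infty, smul_infty_eq_ite]
    simp [Matrix.GeneralLinearGroup.mkOfDetNeZero]

theorem card_projectiveSemilinearGroup [Finite F] :
    Nat.card (projectiveSemilinearGroup K F) =
      Nat.card (affineSemilinearGroup K F) * (Nat.card F + 1) := by
  have : Finite (OnePoint F) := inferInstanceAs (Finite (Option F))
  have horb : MulAction.orbit (projectiveSemilinearGroup K F) (∞ : OnePoint F) = Set.univ := by
    refine Set.eq_univ_of_forall fun y => ?_
    obtain ⟨h, hh, hy⟩ := exists_apply_infty_eq (K := K) y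
    exact ⟨⟨h, hh⟩, hy⟩
  have hcard : Nat.card (OnePoint F) = Nat.card F + 1 := Finite.card_option
  rw [← Nat.card_congr (MulAction.orbitProdStabilizerEquivGroup _ (∞ : OnePoint F)),
    Nat.card_prod, horb, Nat.card_univ, hcard, card_stabilizer_infty, mul_comm]

/-- An element with a fixed point is conjugate to an element of the stabilizer of `∞`, that is, to
an affine map. -/
theorem projective_fixed_point_bounds [Fintype K] [Fintype F] [Fintype (OnePoint F)]
    [DecidableEq (OnePoint F)] {e : ℕ}
    (he : ∀ d ∈ (Module.finrank K F).properDivisors, d ≤ e) {g : Perm (OnePoint F)}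
    (hg : g ∈ projectiveSemilinearGroup K F) (hg1 : g ≠ 1) {y : OnePoint F} (hy : g y = y) :
    (Finset.univ.filter fun x => g x = x).card ≤ Fintype.card K ^ e + 1 ∧
      orderOf g ∣ Nat.card (affineSemilinearGroup K F) := by
  obtain ⟨h, hh, rfl⟩ := exists_apply_infty_eq (K := K) y
  set g' := h⁻¹ * g * h with hg'
  have hgG : g' ∈ projectiveSemilinearGroup K F := mul_mem (mul_mem (inv_mem hh) hg) hh
  have hinf : g' ∞ = ∞ := by simp [hg', hy]
  have hg1' : g' ≠ 1 := fun h1 => hg1 (by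
    have : g = h * g' * h⁻¹ := by rw [hg']; group
    rw [this, h1]; group)
  obtain ⟨f, hf, hfx⟩ := exists_affine_of_apply_infty hgG hinf
  have hf1 : f ≠ 1 := by
    rintro rfl
    refine hg1' (Equiv.ext fun x => ?_)
    cases x with
    | infty => exact hinf
    | coe c => exact hfx c
  constructor
  · have hsub : (Finset.univ.filter fun x => g x = x) ⊆
        insert (h ∞) ((Finset.univ.filter fun x => f x = x).image fun x : F => h x) := by
      intro x hx
      obtain ⟨z, rfl⟩ := h.surjective x
      have hz : g' z = z := by
        have : g (h z) = h z := by simpa using hx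
        simp [hg', this]
      rw [Finset.mem_insert, Finset.mem_image]
      cases z with
      | infty => exact Or.inl rfl
      | coe c =>
        rw [hfx] at hz
        exact Or.inr ⟨c, by simpa using OnePoint.coe_injective hz, rfl⟩
    refine (Finset.card_le_card hsub).trans ((Finset.card_insert_le _ _).trans ?_)
    exact Nat.add_le_add_right (Finset.card_image_le.trans (card_fixed_affine_le he hf hf1)) 1
  · have hord : orderOf g = orderOf g' := by
      rw [← (MulAut.conj h⁻¹).orderOf_eq g, MulAut.conj_apply, inv_inv]
    let t : MulAction.stabilizer (projectiveSemilinearGroup K F) (∞ : OnePoint F) :=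
      ⟨⟨g', hgG⟩, hinf⟩
    have ht : orderOf t = orderOf g' := by
      rw [← Subgroup.orderOf_coe, ← Subgroup.orderOf_coe]
    rw [hord, ← ht, ← card_stabilizer_infty]
    exact orderOf_dvd_natCard t

end Projective

/-! ### Contracted affine and projective semilinear groups -/

section Bounds

variable {K F : Type*} [Field K] [Field F] [Algebra K F] [Fintype K] [Fintype F]

/-- Contracting `AΓL(1, F)`: no two elements lose more than two units of distance per symbol,
because element orders divide the order of the group. -/
theorem card_affine_le_maxPermArray {e m d : ℕ}
    (he : ∀ l ∈ (Module.finrank K F).properDivisors, l ≤ e) (hd : 0 < d)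
    (hle : d + 2 * m + Fintype.card K ^ e ≤ Fintype.card F)
    (hdvd : ∀ i ∈ Finset.Icc 1 m, ¬ 2 * i + 1 ∣ Nat.card (affineSemilinearGroup K F)) :
    Nat.card (affineSemilinearGroup K F) ≤ maxPermArray (Fintype.card F - m) d := by
  classical
  refine card_subgroup_le_maxPermArray _ (by omega) hd fun π hπ hπ1 => Or.inr ⟨?_, ?_⟩
  · have := card_fixed_affine_le he hπ hπ1
    omega
  · intro i hi hdiv
    exact hdvd i hi (hdiv.trans (Subgroup.orderOf_dvd_natCard _ hπ))

/-- Contracting `PΓL(2, F)`: quotients with a fixed point lose two units of distance per symbol, as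
in the affine group, and those without lose at most three. -/
theorem card_projective_le_maxPermArray [DecidableEq F] {e m d : ℕ}
    (he : ∀ l ∈ (Module.finrank K F).properDivisors, l ≤ e) (hd : 0 < d)
    (hle : d + 2 * m + Fintype.card K ^ e ≤ Fintype.card F)
    (hle' : d + 3 * m ≤ Fintype.card F + 1)
    (hdvd : ∀ i ∈ Finset.Icc 1 m, ¬ 2 * i + 1 ∣ Nat.card (affineSemilinearGroup K F)) :
    Nat.card (projectiveSemilinearGroup K F) ≤ maxPermArray (Fintype.card F + 1 - m) d := by
  let _ : Fintype (OnePoint F) := inferInstanceAs (Fintype (Option F))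
  let _ : DecidableEq (OnePoint F) := inferInstanceAs (DecidableEq (Option F))
  have hcard : Fintype.card (OnePoint F) = Fintype.card F + 1 := Fintype.card_option
  rw [← hcard]
  refine card_subgroup_le_maxPermArray _ (by omega) hd fun π hπ hπ1 => ?_
  rcases (Finset.univ.filter fun x => π x = x).eq_empty_or_nonempty with h0 | ⟨y, hy⟩
  · left; rw [h0, Finset.card_empty]; omega
  · obtain ⟨h1, h2⟩ := projective_fixed_point_bounds he hπ hπ1 (Finset.mem_filter.1 hy).2
    exact Or.inr ⟨by omega, fun i hi hdiv => hdvd i hi (hdiv.trans h2)⟩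

end Bounds

theorem corollary5p6 (p k q kstar m : ℕ) (hp : p.Prime) (hk : 2 ≤ k) (hq : q = p ^ k)
    (hkstar : IsGreatest {d : ℕ | d ∈ k.properDivisors} kstar) (hm : 1 ≤ m)
    (hpos : (0 : ℤ) < (q : ℤ) - (p : ℤ) ^ kstar - 2 * (m : ℤ))
    (hdvd : ∀ i ∈ Finset.Icc 1 m, ¬ k * q * (q - 1) ≡ 0 [MOD 2 * i + 1]) :
    k * q * (q - 1) ≤ maxPermArray (q - m) (q - p ^ kstar - 2 * m) ∧
    ((q : ℤ) + 1 - 3 * (m : ℤ) ≥ (q : ℤ) - (p : ℤ) ^ kstar - 2 * (m : ℤ) →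
      k * q * (q - 1) * (q + 1) ≤ maxPermArray (q + 1 - m) (q - p ^ kstar - 2 * m)) := by
  classical
  have : Fact p.Prime := ⟨hp⟩
  have hk0 : k ≠ 0 := by omega
  let F := GaloisField p k
  let _ : Fintype F := Fintype.ofFinite F
  have hF : Fintype.card F = q := by
    rw [← Nat.card_eq_fintype_card, GaloisField.card p k hk0, hq]
  have hfr : Module.finrank (ZMod p) F = k := GaloisField.finrank p hk0
  have he : ∀ l ∈ (Module.finrank (ZMod p) F).properDivisors, l ≤ kstar := fun l hl =>
    hkstar.2 (hfr ▸ hl)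
  have hA : Nat.card (affineSemilinearGroup (ZMod p) F) = k * q * (q - 1) := by
    rw [card_affineSemilinearGroup, hfr, hF]
  have hP : Nat.card (projectiveSemilinearGroup (ZMod p) F) = k * q * (q - 1) * (q + 1) := by
    rw [card_projectiveSemilinearGroup, hA, Nat.card_eq_fintype_card, hF]
  have hdvd' : ∀ i ∈ Finset.Icc 1 m,
      ¬ 2 * i + 1 ∣ Nat.card (affineSemilinearGroup (ZMod p) F) := fun i hi h =>
    hdvd i hi (Nat.modEq_zero_iff_dvd.2 (hA ▸ h))
  have hcast : ((p ^ kstar : ℕ) : ℤ) = (p : ℤ) ^ kstar := Nat.cast_pow p kstar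
  rw [← hcast] at hpos ⊢
  -- By `hpos`, the truncated subtractions agree with those in `ℤ`.
  generalize hQ : p ^ kstar = Q at *
  have hle : (q - Q - 2 * m) + 2 * m + Fintype.card (ZMod p) ^ kstar ≤ Fintype.card F := by
    rw [ZMod.card, hQ, hF]; omega
  refine ⟨?_, fun h => ?_⟩
  · have := card_affine_le_maxPermArray he (by omega) hle hdvd'
    rwa [hA, hF] at this
  · have := card_projective_le_maxPermArray he (by omega) hle (by rw [hF]; omega) hdvd'
    rwa [hP, hF] at this
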